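/- **Model.** Let $V$ be a finite non-empty vertex set, $n=|V|$, $p\in(0,1]$, $q\in[0,1)$. The *edge-Markovian graph* with parameters $p,q$ and initial graph $G_0=(V,E_0)$ is the random sequence of simple undirected graphs $G_0,G_1,G_2,\dots$ on $V$ in which, given $G_t$, the pairs $\{u,v\}\subseteq V$ of distinct vertices evolve independently: a pair that is not an edge of $G_t$ is an edge of $G_{t+1}$ with probability $p$, and a pair that is an edge of $G_t$ is not an edge of $G_{t+1}$ with probability $q$. The *simple load-balancing algorithm* starts with a configuration $\Gamma_0\in\mathbb{N}^V$ of tokens. In step $t$ it picks $v\in V$ uniformly at random and, if $v$ is not isolated in $G_t$, picks a neighbour $u$ of $v$ in $G_t$ uniformly at random and sets $(\Gamma_{t+1}(v),\Gamma_{t+1}(u))$ to $\left(\left\lceil\frac{\Gamma_t(v)+\Gamma_t(u)}2\right\rceil,\left\lfloor\frac{\Gamma_t(v)+\Gamma_t(u)}2\right\rfloor\right)$ or to $\left(\left\lfloor\frac{\Gamma_t(v)+\Gamma_t(u)}2\right\rfloor,\left\lceil\frac{\Gamma_t(v)+\Gamma_t(u)}2\right\rceil\right)$, with probability $1/2$ each;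 all other loads are unchanged (and all loads are unchanged if $v$ is isolated). Then $G_{t+1}$ is generated from $G_t$; given $G_t$, it is independent of the random choices of the algorithm. Put $\mu=\frac1n\sum_{v}\Gamma_0(v)$, $\lceil x\rfloor=\lceil x-\tfrac12\rceil$, $\Delta=\max_v\Gamma_0(v)-\min_v\Gamma_0(v)$, $r=\frac{\max\{p,1-q\}}{\min\{p,1-q\}}$, and $$T_{\mathrm{bal}}=\min\{t\ge 0:\ \Gamma_t(v)\in\{\lceil\mu\rfloor-1,\lceil\mu\rfloor,\lceil\mu\rfloor+1\}\text{ for all }v\in V\}.$$ **Theorem.** For every $\theta>0$ and every $a>0$ there is a constant $C>0$, depending only on $\theta$ and $a$, such that for all $n\ge1$, all $p\in(0,1]$ and $q\in[0,1)$ with $\max\{p,1-q\}\ge\theta/n$, every initial graph $G_0$ on $n$ vertices and every initial configuration $\Gamma_0$, $$\Pr\left[T_{\mathrm{bal}}\le C\,r\,n\,\log(\Delta n)\right]\ \ge\ 1-n^{-a}.$$ (If $\Delta=0$, then $\log(\Delta n)$ is read as $0$, and the claim is that $T_{\mathrm{bal}}=0$ with at least this probability.) -/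

import Mathlib

open MeasureTheory ProbabilityTheory
open scoped ENNReal unitInterval

namespace EdgeMarkov

/-! ### The edge-Markovian evolving graph -/

/-- Probability that a pair of vertices is / is not an edge at time `t + 1` (`after`), given that
it is / is not an edge at time `t` (`before`): a non-edge is born with probability `p`, an edge
dies with probability `q`. -/
noncomputable def pairProb (p q : I) (before after : Prop) : ℝ :=
  open Classical in
  if before then (if after then 1 - (q : ℝ) else (q : ℝ))
  else (if after then (p : ℝ) else 1 - (p : ℝ))

lemma pairProb_nonneg (p q : I) (b a : Prop) : 0 ≤ pairProb p q b a := by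
  have := p.2.1; have := p.2.2; have := q.2.1; have := q.2.2
  unfold pairProb
  split_ifs <;> linarith

lemma pairProb_add (p q : I) (b : Prop) : pairProb p q b True + pairProb p q b False = 1 := by
  by_cases hb : b <;> simp [pairProb, hb]

open Classical in
/-- Transition probability from `G` to `H`: the unordered pairs of distinct vertices evolve
independently. -/
noncomputable def graphProb {V : Type*} [Fintype V] (p q : I) (G H : SimpleGraph V) : ℝ :=
  ∏ e : Sym2 V with ¬ e.IsDiag, pairProb p q (e ∈ G.edgeSet) (e ∈ H.edgeSet)

lemma graphProb_nonneg {V : Type*} [Fintype V] (p q : I) (G H : SimpleGraph V) :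
    0 ≤ graphProb p q G H :=
  Finset.prod_nonneg fun _ _ => pairProb_nonneg p q _ _

open Classical in
lemma graphProb_sum {V : Type*} [Fintype V] (p q : I) (G : SimpleGraph V) :
    ∑ H : SimpleGraph V, graphProb p q G H = 1 := by
  set S : Finset (Sym2 V) := Finset.univ.filter (fun e => ¬ e.IsDiag) with hS
  have h1 : ∏ e ∈ S, (pairProb p q (e ∈ G.edgeSet) True + pairProb p q (e ∈ G.edgeSet) False)
      = 1 := Finset.prod_eq_one fun e _ => pairProb_add p q _
  rw [Finset.prod_add] at h1
  rw [← h1]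
  refine Finset.sum_bij' (fun H _ => H.edgeFinset)
    (fun t _ => SimpleGraph.fromEdgeSet (t : Set (Sym2 V))) ?_ ?_ ?_ ?_ ?_
  · intro H _
    rw [Finset.mem_powerset]
    intro e he
    simp only [hS, Finset.mem_filter, Finset.mem_univ, true_and]
    exact H.not_isDiag_of_mem_edgeFinset he
  · intro t _
    exact Finset.mem_univ _
  · intro H _
    simp
  · intro t ht
    rw [Finset.mem_powerset] at ht
    ext e
    simp only [SimpleGraph.mem_edgeFinset, SimpleGraph.edgeSet_fromEdgeSet, Set.mem_sdiff,
      Finset.mem_coe]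
    constructor
    · exact fun h => h.1
    · intro h
      exact ⟨h, by simpa [hS] using ht h⟩
  · intro H _
    have hsub : H.edgeFinset ⊆ S := by
      intro e he
      simp only [hS, Finset.mem_filter, Finset.mem_univ, true_and]
      exact H.not_isDiag_of_mem_edgeFinset he
    have h2 : graphProb p q G H
        = ∏ e ∈ S, pairProb p q (e ∈ G.edgeSet) (e ∈ H.edgeSet) := rfl
    rw [h2, ← Finset.prod_sdiff hsub, mul_comm]
    congr 1
    · refine Finset.prod_congr rfl fun e he => ?_
      rw [SimpleGraph.mem_edgeFinset] at he
      simp [he]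
    · refine Finset.prod_congr rfl fun e he => ?_
      rw [Finset.mem_sdiff, SimpleGraph.mem_edgeFinset] at he
      simp [he.2]

open Classical in
/-- The law of `G_{t+1}` given `G_t = G` in the edge-Markovian graph with parameters `p`, `q`. -/
noncomputable def graphStep {V : Type*} [Fintype V] (p q : I) (G : SimpleGraph V) :
    PMF (SimpleGraph V) :=
  PMF.ofFintype (fun H => ENNReal.ofReal (graphProb p q G H)) (by
    rw [← ENNReal.ofReal_sum_of_nonneg
      fun H _ => graphProb_nonneg p q G H, graphProb_sum,
      ENNReal.ofReal_one])

/-! ### The simple load-balancing algorithm -/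

open Classical in
/-- The random matching of the simple load-balancing algorithm: a uniformly random vertex `v`
picks a uniformly random neighbour `u`. The value `some (v, u)` stands for the matching
`{{v, u}}`, and `none` for the empty matching (when `v` is isolated). -/
noncomputable def simpleMatching {V : Type*} [Fintype V] [Nonempty V] (G : SimpleGraph V) :
    PMF (Option (V × V)) :=
  (PMF.uniformOfFintype V).bind fun v =>
    if h : (Finset.univ.filter (fun u => G.Adj v u)).Nonempty then
      (PMF.uniformOfFinset (Finset.univ.filter (fun u => G.Adj v u)) h).map fun u => some (v, u)
    else PMF.pure none

open Classical in
/-- The configuration in which `v` receives `⌈(Γ v + Γ u) / 2⌉` tokens and `u` receives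
`⌊(Γ v + Γ u) / 2⌋` tokens, all other vertices keeping theirs. -/
noncomputable def balancePair {V : Type*} (Γ : V → ℕ) (v u : V) : V → ℕ := fun w =>
  if w = v then (Γ v + Γ u + 1) / 2 else if w = u then (Γ v + Γ u) / 2 else Γ w

/-- Balancing across the matching with random rounding: the surplus token, if any, goes to either
endpoint with probability `1 / 2`. -/
noncomputable def balance {V : Type*} (Γ : V → ℕ) : Option (V × V) → PMF (V → ℕ)
  | none => PMF.pure Γ
  | some (v, u) => (PMF.uniformOfFintype Bool).map fun c =>
      if c then balancePair Γ v u else balancePair Γ u v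

/-! ### The execution -/

/-- The state at time `t`: the token configuration `Γ_t` and the graph `G_t`. -/
structure State (V : Type*) where
  load : V → ℕ
  graph : SimpleGraph V

instance (V : Type*) : MeasurableSpace (State V) := ⊤

instance (V : Type*) : DiscreteMeasurableSpace (State V) := ⟨fun _ => trivial⟩

instance (V : Type*) [Finite V] : Countable (State V) :=
  Function.Injective.countable (β := (V → ℕ) × SimpleGraph V)
    (f := fun s => (s.load, s.graph)) fun s t h => by
      cases s; cases t; simpa using h

/-- One time step: a matching of `G_t` is drawn, the loads are balanced across it, and the graph
moves on (given `G_t`, independently of the matching and the rounding). -/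
noncomputable def step {V : Type*} [Fintype V] [Nonempty V] (p q : I) (s : State V) :
    PMF (State V) :=
  (simpleMatching s.graph).bind fun M =>
    (balance s.load M).bind fun Γ' =>
      (graphStep p q s.graph).map fun G' => ⟨Γ', G'⟩

/-- The one-step Markov kernel. -/
noncomputable def stepKernel {V : Type*} [Fintype V] [Nonempty V] (p q : I) :
    Kernel (State V) (State V) :=
  Kernel.ofFunOfCountable fun s => (step p q s).toMeasure

instance {V : Type*} [Fintype V] [Nonempty V] (p q : I) :
    IsMarkovKernel (stepKernel (V := V) p q) :=
  ⟨fun s => inferInstanceAs (IsProbabilityMeasure (step p q s).toMeasure)⟩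

/-- The kernel giving the state at time `t + 1` from the history up to time `t`; it only uses the
state at time `t`. -/
noncomputable def historyKernel {V : Type*} [Fintype V] [Nonempty V] (p q : I) (t : ℕ) :
    Kernel (Π _ : Finset.Iic t, State V) (State V) :=
  (stepKernel p q).comap (fun h => h ⟨t, Finset.mem_Iic.2 le_rfl⟩) (measurable_pi_apply _)

instance {V : Type*} [Fintype V] [Nonempty V] (p q : I) (t : ℕ) :
    IsMarkovKernel (historyKernel (V := V) p q t) :=
  inferInstanceAs (IsMarkovKernel ((stepKernel p q).comap _ _))

/-- The law, on infinite trajectories, of the simple load-balancing algorithm on the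
edge-Markovian graph, started from the configuration `Γ₀` and the graph `G₀`. -/
noncomputable def executionLaw {V : Type*} [Fintype V] [Nonempty V] (p q : I)
    (Γ₀ : V → ℕ) (G₀ : SimpleGraph V) : Measure (ℕ → State V) :=
  Kernel.traj (X := fun _ => State V) (historyKernel p q) 0 (fun _ => ⟨Γ₀, G₀⟩)

/-! ### The balancing time -/

/-- The average number of tokens per vertex. -/
noncomputable def averageLoad {V : Type*} [Fintype V] (Γ : V → ℕ) : ℝ :=
  (∑ v, (Γ v : ℝ)) / Fintype.card V

/-- The nearest integer, half-integers being rounded down. -/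
noncomputable def nearestInt (x : ℝ) : ℤ := ⌈x - 1 / 2⌉

/-- The discrepancy `max_v Γ(v) - min_v Γ(v)`. -/
def discrepancy {V : Type*} [Fintype V] [Nonempty V] (Γ : V → ℕ) : ℕ :=
  Finset.univ.sup' Finset.univ_nonempty Γ - Finset.univ.inf' Finset.univ_nonempty Γ

/-- Every load differs by at most one from the integer `m`. -/
def IsBalancedAround {V : Type*} (m : ℤ) (Γ : V → ℕ) : Prop :=
  ∀ v, (Γ v : ℤ) = m - 1 ∨ (Γ v : ℤ) = m ∨ (Γ v : ℤ) = m + 1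

/-- The balancing time of a trajectory with initial configuration `Γ₀`: the first time at which
all loads are in `{m - 1, m, m + 1}`, where `m` is the rounded average load; `⊤` if there is no
such time. -/
noncomputable def balancingTime {V : Type*} [Fintype V] (Γ₀ : V → ℕ) (ω : ℕ → State V) : ℕ∞ :=
  ⨅ (t : ℕ) (_ : IsBalancedAround (nearestInt (averageLoad Γ₀)) (ω t).load), (t : ℕ∞)

/-- `r = max{p, 1 - q} / min{p, 1 - q}`. -/
noncomputable def ratio (p q : I) : ℝ := max (p : ℝ) (1 - q) / min (p : ℝ) (1 - q)

end EdgeMarkov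

namespace EdgeMarkov

/-! ### Expectations with respect to a probability mass function -/

/-! Write m = min(p, 1-q) and M = max(p, 1-q). Whatever the current graph is, each pair is an edge
of the next graph independently, with probability between m and M. So, given the present, a fixed
ordered pair (v, u) is selected one step later with probability at least κ = m / (n (1 + nM)): u is
a neighbour of v with probability at least m, and then v has at most 1 + nM neighbours on average
(`le_graphStep_bind_simpleMatching`). Up to this loss, the algorithm behaves as on the complete
graph.

The squared deviations from μ, with sum φ, contract well only while rounding is negligible, that is,
while φ ≥ n. Below that level they are replaced by the squared distances of the loads to {m-1, m,
m+1}, where m now denotes the rounded mean; this quantity vanishes exactly on balanced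
configurations. As φ < n bounds the second moment, any badly placed load still has enough useful
partners. In both regimes the decrease summed over ordered pairs is at least 3n/32 times the
potential (`le_sum_gain_loadPotential`), and changing regime never increases the potential.

Hence the expected potential shrinks by the factor 1 - 3κn/32 per step (`expect_cappedPotential_le`,
`lintegral_cappedPotential_le`). It starts at most at nΔ², and a value below 1 forces balance, so
Markov's inequality finishes; nM ≥ θ turns the rate κn into a constant times 1/(rn). -/

/-- The expectation of a nonnegative extended function under a probability mass function. -/
noncomputable def expect {α : Type*} (P : PMF α) (f : α → ℝ≥0∞) : ℝ≥0∞ := ∑' a, P a * f a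

lemma expect_bind {α β : Type*} (P : PMF α) (g : α → PMF β) (f : β → ℝ≥0∞) :
    expect (P.bind g) f = expect P fun a => expect (g a) f := by
  simp_rw [expect, PMF.bind_apply, ← ENNReal.tsum_mul_right, ← ENNReal.tsum_mul_left]
  rw [ENNReal.tsum_comm]
  simp_rw [mul_assoc]

lemma expect_pure {α : Type*} (a : α) (f : α → ℝ≥0∞) : expect (PMF.pure a) f = f a := by
  rw [expect, tsum_eq_single a fun b hb => by simp [PMF.pure_apply, hb]]
  simp

lemma expect_map {α β : Type*} (P : PMF α) (g : α → β) (f : β → ℝ≥0∞) :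
    expect (P.map g) f = expect P fun a => f (g a) := by
  rw [PMF.map, expect_bind]
  simp_rw [Function.comp_apply, expect_pure]

lemma expect_mono {α : Type*} (P : PMF α) {f g : α → ℝ≥0∞} (h : ∀ a, f a ≤ g a) :
    expect P f ≤ expect P g :=
  ENNReal.tsum_le_tsum fun a => by gcongr; exact h a

lemma expect_const {α : Type*} (P : PMF α) (c : ℝ≥0∞) : expect P (fun _ => c) = c := by
  rw [expect, ENNReal.tsum_mul_right, P.tsum_coe, one_mul]

lemma expect_const_mul {α : Type*} (P : PMF α) (c : ℝ≥0∞) (f : α → ℝ≥0∞) :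
    expect P (fun a => c * f a) = c * expect P f := by
  rw [expect, expect, ← ENNReal.tsum_mul_left]
  simp_rw [mul_left_comm]

lemma expect_add {α : Type*} (P : PMF α) (f g : α → ℝ≥0∞) :
    expect P (fun a => f a + g a) = expect P f + expect P g := by
  simp_rw [expect, mul_add]
  exact ENNReal.tsum_add

lemma lintegral_toMeasure {α : Type*} [MeasurableSpace α] [Countable α]
    [MeasurableSingletonClass α] (P : PMF α) (f : α → ℝ≥0∞) :
    ∫⁻ a, f a ∂P.toMeasure = expect P f := by
  rw [lintegral_countable', expect]
  simp_rw [PMF.toMeasure_apply_singleton P _ (measurableSet_singleton _), mul_comm]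

variable {V : Type*} [Fintype V] [Nonempty V]

lemma expect_step (p q : I) (s : State V) (F : State V → ℝ≥0∞) :
    expect (step p q s) F = expect (simpleMatching s.graph) fun M =>
      expect (balance s.load M) fun Γ' => expect (graphStep p q s.graph) fun G' => F ⟨Γ', G'⟩ := by
  simp_rw [step, expect_bind, expect_map]

/-! ### Expectations along the execution -/

lemma lintegral_executionLaw_zero (p q : I) (Γ₀ : V → ℕ) (G₀ : SimpleGraph V)
    (f : State V → ℝ≥0∞) :
    ∫⁻ ω, f (ω 0) ∂executionLaw p q Γ₀ G₀ = f ⟨Γ₀, G₀⟩ := by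
  have hf : Measurable f := Measurable.of_discrete
  have : IsProbabilityMeasure (executionLaw p q Γ₀ G₀) := by unfold executionLaw; infer_instance
  refine (Kernel.lintegral_traj (X := fun _ => State V) (κ := historyKernel p q) (a := 0)
    (fun _ => ⟨Γ₀, G₀⟩) (f := fun ω => f (ω 0)) (by fun_prop)).trans ?_
  change ∫⁻ _, f ⟨Γ₀, G₀⟩ ∂executionLaw p q Γ₀ G₀ = _
  simp

/-- The Markov property: the marginal at time `t + 1` is the history up to `t` pushed through the
step kernel, which sees only the last state. -/
lemma lintegral_executionLaw_succ (p q : I) (Γ₀ : V → ℕ) (G₀ : SimpleGraph V) (t : ℕ)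
    (f : State V → ℝ≥0∞) :
    ∫⁻ ω, f (ω (t + 1)) ∂executionLaw p q Γ₀ G₀ =
      ∫⁻ ω, expect (step p q (ω t)) f ∂executionLaw p q Γ₀ G₀ := by
  have hf : Measurable f := Measurable.of_discrete
  have hg : Measurable fun s : State V => expect (step p q s) f := Measurable.of_discrete
  set x₀ : Π _ : Finset.Iic 0, State V := fun _ => ⟨Γ₀, G₀⟩
  have h1 : (Kernel.traj (X := fun _ => State V) (historyKernel p q) 0).map (fun x => x (t + 1))
      = historyKernel p q t ∘ₖ
        Kernel.partialTraj (X := fun _ => State V) (historyKernel p q) 0 t := by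
    rw [← Kernel.traj_comp_partialTraj (X := fun _ => State V) (κ := historyKernel p q)
      (Nat.zero_le t), Kernel.map_comp]
    congr 1
    exact Kernel.map_traj_succ_self (X := fun _ => State V) (κ := historyKernel p q)
  calc ∫⁻ ω, f (ω (t + 1)) ∂executionLaw p q Γ₀ G₀
      = ∫⁻ s, f s ∂((Kernel.traj (X := fun _ => State V) (historyKernel p q) 0).map
          (fun x => x (t + 1)) x₀) := by
        rw [Kernel.lintegral_map _ (by fun_prop) _ hf]; rfl
    _ = ∫⁻ x, ∫⁻ s, f s ∂(historyKernel p q t x)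
          ∂(Kernel.partialTraj (X := fun _ => State V) (historyKernel p q) 0 t x₀) := by
        rw [h1, Kernel.lintegral_comp _ _ _ hf]
    _ = ∫⁻ x, expect (step p q (x ⟨t, Finset.mem_Iic.2 le_rfl⟩)) f
          ∂(Kernel.partialTraj (X := fun _ => State V) (historyKernel p q) 0 t x₀) := by
        refine lintegral_congr fun x => ?_
        rw [← lintegral_toMeasure]
        rfl
    _ = ∫⁻ ω, expect (step p q (ω t)) f ∂executionLaw p q Γ₀ G₀ := by
        rw [← Kernel.traj_map_frestrictLe_apply]
        exact lintegral_map
          (f := fun x : Finset.Iic t → State V =>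
            expect (step p q (x ⟨t, Finset.mem_Iic.2 le_rfl⟩)) f)
          (hg.comp (measurable_pi_apply (X := fun _ : Finset.Iic t => State V) _))
          (Preorder.measurable_frestrictLe (X := fun _ => State V) t)

/-! ### Edge probabilities after one step of the graph -/

-- Expanding the product gives one term for each set of non-diagonal pairs, and such sets are
-- exactly the simple graphs. Arbitrary weights `g` allow events to be encoded in the factors.
open Classical in
lemma sum_prod_edgeSet {V : Type*} [Fintype V] (g : Sym2 V → Prop → ℝ) :
    ∑ H : SimpleGraph V, ∏ e : Sym2 V with ¬ e.IsDiag, g e (e ∈ H.edgeSet) =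
      ∏ e : Sym2 V with ¬ e.IsDiag, (g e True + g e False) := by
  set S : Finset (Sym2 V) := Finset.univ.filter (fun e => ¬ e.IsDiag) with hS
  rw [Finset.prod_add]
  refine Finset.sum_bij' (fun H _ => H.edgeFinset)
    (fun t _ => SimpleGraph.fromEdgeSet (t : Set (Sym2 V))) ?_ ?_ ?_ ?_ ?_
  · intro H _
    rw [Finset.mem_powerset]
    intro e he
    simp only [hS, Finset.mem_filter, Finset.mem_univ, true_and]
    exact H.not_isDiag_of_mem_edgeFinset he
  · intro t _
    exact Finset.mem_univ _
  · intro H _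
    simp
  · intro t ht
    rw [Finset.mem_powerset] at ht
    ext e
    simp only [SimpleGraph.mem_edgeFinset, SimpleGraph.edgeSet_fromEdgeSet, Set.mem_sdiff,
      Finset.mem_coe]
    exact ⟨fun h => h.1, fun h => ⟨h, by simpa [hS] using ht h⟩⟩
  · intro H _
    have hsub : H.edgeFinset ⊆ S := by
      intro e he
      simp only [hS, Finset.mem_filter, Finset.mem_univ, true_and]
      exact H.not_isDiag_of_mem_edgeFinset he
    rw [← Finset.prod_sdiff hsub, mul_comm]
    congr 1
    · refine Finset.prod_congr rfl fun e he => ?_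
      rw [SimpleGraph.mem_edgeFinset] at he
      simp [he]
    · refine Finset.prod_congr rfl fun e he => ?_
      rw [Finset.mem_sdiff, SimpleGraph.mem_edgeFinset] at he
      simp [he.2]

open Classical in
/-- The probability that all the pairs in `A` are edges after one step is the product of the
probabilities of the single pairs. -/
lemma sum_graphProb_subset {V : Type*} [Fintype V] (p q : I) (G : SimpleGraph V)
    (A : Finset (Sym2 V)) (hA : ∀ e ∈ A, ¬ e.IsDiag) :
    ∑ H : SimpleGraph V, graphProb p q G H * (if ∀ e ∈ A, e ∈ H.edgeSet then 1 else 0) =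
      ∏ e ∈ A, pairProb p q (e ∈ G.edgeSet) True := by
  refine Eq.trans (Finset.sum_congr rfl fun H _ => ?_)
    -- The event is encoded by giving weight zero to an absent pair of `A`; each factor outside `A`
    -- then sums to 1.
    ((sum_prod_edgeSet (V := V) fun e b =>
      pairProb p q (e ∈ G.edgeSet) b * (if e ∈ A ∧ ¬ b then 0 else 1)).trans ?_)
  · rw [Finset.prod_mul_distrib, graphProb]
    congr 1
    split_ifs with hH
    · exact (Finset.prod_eq_one fun e _ => if_neg fun h => h.2 (hH e h.1)).symm
    · push Not at hH
      obtain ⟨e, he, heH⟩ := hH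
      symm
      refine Finset.prod_eq_zero (i := e) (by simpa using hA e he) ?_
      exact if_pos ⟨he, heH⟩
  have hsub : A ⊆ (Finset.univ.filter fun e : Sym2 V => ¬ e.IsDiag) := fun e he => by
    simpa using hA e he
  rw [← Finset.prod_subset hsub]
  · exact Finset.prod_congr rfl fun e he => by simp [he]
  · intro e _ he
    simpa [he] using pairProb_add p q (e ∈ G.edgeSet)

lemma min_le_pairProb (p q : I) (b : Prop) : min (p : ℝ) (1 - q) ≤ pairProb p q b True := by
  by_cases hb : b <;> simp [pairProb, hb]

lemma pairProb_le_max (p q : I) (b : Prop) : pairProb p q b True ≤ max (p : ℝ) (1 - q) := by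
  by_cases hb : b <;> simp [pairProb, hb]

open Classical in
/-- After one step of the graph, the expectation of `1 / deg v` on the event that `{v, u}` is an
edge is at least `m / (1 + n M)` if all edge probabilities lie between `m` and `M`. -/
lemma le_sum_graphProb_div_degree {V : Type*} [Fintype V] (p q : I) (G : SimpleGraph V)
    {v u : V} (huv : v ≠ u) :
    min (p : ℝ) (1 - q) / (1 + Fintype.card V * max (p : ℝ) (1 - q)) ≤
      ∑ H : SimpleGraph V, graphProb p q G H *
        (if H.Adj v u then ((Finset.univ.filter fun w => H.Adj v w).card : ℝ)⁻¹ else 0) := by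
  set M := max (p : ℝ) (1 - q)
  have hM : 0 ≤ M := le_max_of_le_left p.2.1
  -- An upper bound for the mean degree of `v` given the edge `{v, u}`: 1 for `u` itself, at most
  -- `M` for any other vertex by independence.
  set k : ℝ := 1 + Fintype.card V * M
  have hk : 0 < k := by positivity
  set P := pairProb p q (G.Adj v u) True with hP
  have hP0 : 0 ≤ P := pairProb_nonneg _ _ _ _
  have hA : ∑ H : SimpleGraph V, graphProb p q G H * (if H.Adj v u then 1 else 0) = P := by
    have := sum_graphProb_subset p q G {s(v, u)} (by simpa using huv)
    simpa using this
  have hAw : ∀ w, ∑ H : SimpleGraph V, graphProb p q G H *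
      ((if H.Adj v u then 1 else 0) * (if H.Adj v w then 1 else 0)) ≤
        P * M + if w = u then P else 0 := by
    intro w
    by_cases hwu : w = u
    · subst hwu
      have : ∀ H : SimpleGraph V, ((if H.Adj v w then 1 else 0) * (if H.Adj v w then 1 else 0) : ℝ)
          = if H.Adj v w then 1 else 0 := fun H => by split_ifs <;> simp
      simp_rw [this, hA]
      simp
      positivity
    by_cases hwv : v = w
    · subst hwv
      simp only [SimpleGraph.irrefl, if_false, mul_zero, Finset.sum_const_zero]
      split_ifs
      all_goals positivity
    have hne : s(v, u) ≠ s(v, w) := by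
      simp [Ne.symm hwu]
      exact fun h => absurd h hwv
    have := sum_graphProb_subset p q G {s(v, u), s(v, w)} (by simp [huv, hwv])
    rw [Finset.prod_pair hne] at this
    simp only [Finset.mem_insert, Finset.mem_singleton, forall_eq_or_imp, forall_eq,
      SimpleGraph.mem_edgeSet, ite_and] at this
    simp only [hwu, if_false, add_zero]
    calc _ = _ := ?_
      _ ≤ P * M := mul_le_mul_of_nonneg_left (pairProb_le_max p q (G.Adj v w)) hP0
    rw [← this]
    refine Finset.sum_congr rfl fun H _ => ?_
    split_ifs <;> simp
  have hdeg : ∀ H : SimpleGraph V, ((Finset.univ.filter fun w => H.Adj v w).card : ℝ) =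
      ∑ w, if H.Adj v w then 1 else 0 := fun H => by simp
  have hsum : ∑ H : SimpleGraph V, graphProb p q G H * ((if H.Adj v u then 1 else 0) *
      ((Finset.univ.filter fun w => H.Adj v w).card : ℝ)) ≤ P * k := by
    simp_rw [hdeg, Finset.mul_sum]
    rw [Finset.sum_comm]
    refine (Finset.sum_le_sum fun w _ => hAw w).trans (le_of_eq ?_)
    rw [Finset.sum_add_distrib]
    simp [k]
    ring
  -- The convex function 1/d lies above its tangent at `k`, namely 2/k - d/k². This bound is linear
  -- in d, so only the mean of the degree on the event is needed.
  have hpt : ∀ H : SimpleGraph V, 2 / k * (graphProb p q G H * (if H.Adj v u then 1 else 0)) -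
      1 / k ^ 2 * (graphProb p q G H * ((if H.Adj v u then 1 else 0) *
      ((Finset.univ.filter fun w => H.Adj v w).card : ℝ))) ≤ graphProb p q G H *
        (if H.Adj v u then ((Finset.univ.filter fun w => H.Adj v w).card : ℝ)⁻¹ else 0) := by
    intro H
    have hg := graphProb_nonneg p q G H
    split_ifs with hadj
    · set d := ((Finset.univ.filter fun w => H.Adj v w).card : ℝ)
      have hd : 0 < d := by
        have : 0 < (Finset.univ.filter fun w => H.Adj v w).card :=
          Finset.card_pos.2 ⟨u, by simpa using hadj⟩
        exact Nat.cast_pos.2 this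
      have h1 : 2 / k - d / k ^ 2 ≤ d⁻¹ := by
        have : d⁻¹ - (2 / k - d / k ^ 2) = (d - k) ^ 2 / (d * k ^ 2) := by field_simp; ring
        have : 0 ≤ (d - k) ^ 2 / (d * k ^ 2) := by positivity
        linarith
      calc _ = graphProb p q G H * (2 / k - d / k ^ 2) := by ring
        _ ≤ _ := mul_le_mul_of_nonneg_left h1 hg
    · simp
  calc min (p : ℝ) (1 - q) / k ≤ P / k := by
        gcongr; exact min_le_pairProb _ _ _
    _ = 2 / k * P - 1 / k ^ 2 * (P * k) := by field_simp; ring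
    _ ≤ 2 / k * P - 1 / k ^ 2 * ∑ H : SimpleGraph V, graphProb p q G H *
        ((if H.Adj v u then 1 else 0) * ((Finset.univ.filter fun w => H.Adj v w).card : ℝ)) := by
      gcongr
    _ ≤ _ := by
      rw [← hA, Finset.mul_sum, Finset.mul_sum, ← Finset.sum_sub_distrib]
      exact Finset.sum_le_sum fun H _ => hpt H

open Classical in
lemma le_simpleMatching {V : Type*} [Fintype V] [Nonempty V] (H : SimpleGraph V) (v u : V) :
    ENNReal.ofReal ((Fintype.card V : ℝ)⁻¹ *
      (if H.Adj v u then ((Finset.univ.filter fun w => H.Adj v w).card : ℝ)⁻¹ else 0)) ≤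
      simpleMatching H (some (v, u)) := by
  split_ifs with hadj
  swap
  · simp
  have hne : (Finset.univ.filter fun w => H.Adj v w).Nonempty := ⟨u, by simpa using hadj⟩
  rw [simpleMatching, PMF.bind_apply]
  refine le_trans ?_ (ENNReal.le_tsum v)
  rw [dif_pos hne, PMF.map_apply, PMF.uniformOfFintype_apply]
  rw [ENNReal.ofReal_mul (by positivity), ENNReal.ofReal_inv_of_pos (by positivity),
    ENNReal.ofReal_inv_of_pos (by simpa using hne), ENNReal.ofReal_natCast, ENNReal.ofReal_natCast]
  gcongr
  refine le_trans ?_ (ENNReal.le_tsum u)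
  rw [if_pos rfl, PMF.uniformOfFinset_apply, if_pos (by simpa using hadj)]

open Classical in
/-- Every ordered pair of distinct vertices is the matching in the next graph with probability at
least `m / (n (1 + n M))`. -/
lemma le_graphStep_bind_simpleMatching {V : Type*} [Fintype V] [Nonempty V] (p q : I)
    (G : SimpleGraph V) {v u : V} (huv : v ≠ u) :
    ENNReal.ofReal ((Fintype.card V : ℝ)⁻¹ *
      (min (p : ℝ) (1 - q) / (1 + Fintype.card V * max (p : ℝ) (1 - q)))) ≤
      ((graphStep p q G).bind simpleMatching) (some (v, u)) := by
  rw [PMF.bind_apply, tsum_fintype]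
  calc _ ≤ ENNReal.ofReal (∑ H : SimpleGraph V, graphProb p q G H * ((Fintype.card V : ℝ)⁻¹ *
        (if H.Adj v u then ((Finset.univ.filter fun w => H.Adj v w).card : ℝ)⁻¹ else 0))) := by
        refine ENNReal.ofReal_le_ofReal ?_
        simp_rw [mul_left_comm (graphProb p q G _), ← Finset.mul_sum]
        exact mul_le_mul_of_nonneg_left (le_sum_graphProb_div_degree p q G huv) (by positivity)
    _ = ∑ H : SimpleGraph V, ENNReal.ofReal (graphProb p q G H) *
        ENNReal.ofReal ((Fintype.card V : ℝ)⁻¹ *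
        (if H.Adj v u then ((Finset.univ.filter fun w => H.Adj v w).card : ℝ)⁻¹ else 0)) := by
        rw [ENNReal.ofReal_sum_of_nonneg]
        · exact Finset.sum_congr rfl fun H _ => ENNReal.ofReal_mul (graphProb_nonneg p q G H)
        · exact fun H _ => mul_nonneg (graphProb_nonneg p q G H)
            (by split_ifs; all_goals positivity)
    _ ≤ _ := by
        refine Finset.sum_le_sum fun H _ => ?_
        rw [graphStep, PMF.ofFintype_apply]
        gcongr
        exact le_simpleMatching H v u

/-! ### The potential -/

/-- The square of the distance of an integer to `{-1, 0, 1}`. -/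
def excess (y : ℤ) : ℤ := max (|y| - 1) 0 ^ 2

lemma excess_nonneg (y : ℤ) : 0 ≤ excess y := sq_nonneg _

lemma excess_neg (y : ℤ) : excess (-y) = excess y := by rw [excess, excess, abs_neg]

lemma excess_of_one_le {y : ℤ} (h : 1 ≤ y) : excess y = (y - 1) ^ 2 := by
  rw [excess, abs_of_nonneg (by omega), max_eq_left (by omega)]

lemma excess_of_le_neg_one {y : ℤ} (h : y ≤ -1) : excess y = (y + 1) ^ 2 := by
  rw [← excess_neg, excess_of_one_le (by omega)]
  ring

lemma excess_eq_zero {y : ℤ} (h : -1 ≤ y) (h' : y ≤ 1) : excess y = 0 := by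
  rw [excess, max_eq_right]
  · rfl
  · have := abs_le.2 ⟨h, h'⟩
    omega

lemma one_le_excess {y : ℤ} (h : y < -1 ∨ 1 < y) : 1 ≤ excess y := by
  rcases h with h | h
  · rw [excess_of_le_neg_one (by omega)]; nlinarith
  · rw [excess_of_one_le (by omega)]; nlinarith

/-- Convexity: `c`, `d` is the most even integer split of the sum `y + z`. -/
lemma excess_add_excess_le {y z c d : ℤ} (hs : c + d = y + z) (hcd : c = d ∨ c = d + 1) :
    excess c + excess d ≤ excess y + excess z := by
  wlog hzy : z ≤ y generalizing y z
  · rw [add_comm (excess y)]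
    exact this (by omega) (by omega)
  have hy := excess_nonneg y
  have hz := excess_nonneg z
  rcases le_or_gt 1 d with hd | hd
  · rw [excess_of_one_le hd, excess_of_one_le (by omega : 1 ≤ c)]
    rw [excess_of_one_le (by omega : 1 ≤ y)] at hy ⊢
    rcases le_or_gt 1 z with h | h
    · rw [excess_of_one_le h]
      obtain rfl : y = c + d - z := by omega
      rcases hcd with rfl | rfl <;> nlinarith
    · obtain ⟨w, hw, rfl⟩ : ∃ w, 0 ≤ w ∧ y = c + d + w := ⟨-z, by omega, by omega⟩
      rcases hcd with rfl | rfl <;> nlinarith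
  rcases le_or_gt c (-1) with hc | hc
  · rw [excess_of_le_neg_one hc, excess_of_le_neg_one (by omega : d ≤ -1)]
    rw [excess_of_le_neg_one (by omega : z ≤ -1)] at hz ⊢
    rcases le_or_gt y (-1) with h | h
    · rw [excess_of_le_neg_one h]
      obtain rfl : z = c + d - y := by omega
      rcases hcd with rfl | rfl <;> nlinarith
    · obtain ⟨w, hw, rfl⟩ : ∃ w, 0 ≤ w ∧ z = c + d - w := ⟨y, by omega, by omega⟩
      rcases hcd with rfl | rfl <;> nlinarith
  · rw [excess_eq_zero (by omega : -1 ≤ c) (by omega), excess_eq_zero (by omega : -1 ≤ d) (by omega)]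
    omega

/-- The factor 3 - 2z - z² = 4 - (z + 1)² is a quadratic lower estimate of how useful the partner
`z` is. Being quadratic, it can be summed over all partners knowing only their first two moments. -/
lemma excess_mul_le_of_nonneg {y z c d : ℤ} (hs : c + d = y + z) (hcd : c = d ∨ c = d + 1)
    (hy : 0 ≤ y) :
    excess y * (3 - 2 * z - z ^ 2) ≤ 8 * (excess y + excess z - excess c - excess d) := by
  have hle := excess_add_excess_le hs hcd
  have hy0 := excess_nonneg y
  have hz0 := excess_nonneg z
  rcases le_or_gt 1 z with hz | hz
  -- Here the factor -(z - 1)(z + 3) is nonpositive, so it is enough that the excess does not grow.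
  · nlinarith [mul_nonneg hy0 (by nlinarith : 0 ≤ z ^ 2 + 2 * z - 3)]
  rcases le_or_gt y 1 with hy1 | hy1
  · rw [excess_eq_zero (by omega) hy1] at hle ⊢
    linarith
  -- A partner `z ≤ 0` removes at least half the excess of `y`, and the factor is at most 4.
  suffices h : 2 * (excess c + excess d) ≤ excess y + 2 * excess z by
    nlinarith [mul_nonneg hy0 (sq_nonneg (z + 1))]
  rcases le_or_gt 1 d with hd | hd
  · rw [excess_of_one_le hd, excess_of_one_le (by omega : 1 ≤ c), excess_of_one_le hy1.le]
    have h1 : 0 ≤ y - (c + d) := by omega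
    have h2 : 2 ≤ c + d := by omega
    rcases hcd with rfl | rfl <;> nlinarith
  rcases le_or_gt c (-1) with hc | hc
  · rw [excess_of_le_neg_one hc, excess_of_le_neg_one (by omega : d ≤ -1)]
    rw [excess_of_le_neg_one (by omega : z ≤ -1)] at hz0 ⊢
    obtain rfl : z = c + d - y := by omega
    rcases hcd with rfl | rfl <;> nlinarith
  · rw [excess_eq_zero (by omega : -1 ≤ c) (by omega), excess_eq_zero (by omega : -1 ≤ d) (by omega)]
    omega

lemma excess_mul_le_of_nonpos {y z c d : ℤ} (hs : c + d = y + z) (hcd : c = d ∨ c = d + 1)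
    (hy : y ≤ 0) :
    excess y * (3 + 2 * z - z ^ 2) ≤ 8 * (excess y + excess z - excess c - excess d) := by
  -- Reflection swaps the roles of `c` and `d`, which keeps the larger half first.
  have := excess_mul_le_of_nonneg (y := -y) (z := -z) (c := -d) (d := -c) (by omega) (by omega)
    (by omega)
  simp only [excess_neg] at this
  linarith [show 3 - 2 * -z - (-z) ^ 2 = 3 + 2 * z - z ^ 2 by ring]

/-! ### Gain from balancing one pair -/

/-- The decrease of `g a + g b` when the loads `a` and `b` are balanced. -/
noncomputable def gain (g : ℕ → ℝ) (a b : ℕ) : ℝ :=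
  g a + g b - g ((a + b + 1) / 2) - g ((a + b) / 2)

lemma gain_comm (g : ℕ → ℝ) (a b : ℕ) : gain g a b = gain g b a := by
  rw [gain, gain, add_comm a b, add_comm (g a)]

lemma gain_self (g : ℕ → ℝ) (a : ℕ) : gain g a a = 0 := by
  rw [gain, show (a + a + 1) / 2 = a by omega, show (a + a) / 2 = a by omega]
  ring

lemma half_sum (a b : ℕ) : ((a + b + 1) / 2 + (a + b) / 2 = a + b) ∧
    ((a + b + 1) / 2 = (a + b) / 2 ∨ (a + b + 1) / 2 = (a + b) / 2 + 1) := by omega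

variable {V : Type*} [Fintype V]

lemma sum_balancePair (g : ℕ → ℝ) (Γ : V → ℕ) (v u : V) :
    ∑ w, g (balancePair Γ v u w) = ∑ w, g (Γ w) - gain g (Γ v) (Γ u) := by
  classical
  rcases eq_or_ne v u with rfl | huv
  · rw [gain_self, sub_zero]
    refine Finset.sum_congr rfl fun w _ => ?_
    unfold balancePair
    split_ifs with h
    · rw [h]; congr 1; omega
    · rfl
  have hu : u ∈ Finset.univ.erase v := by simp [huv.symm]
  have split : ∀ k : V → ℝ, ∑ w, k w = k v + (k u + ∑ w ∈ (Finset.univ.erase v).erase u, k w) :=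
    fun k => by rw [Finset.add_sum_erase _ _ hu, Finset.add_sum_erase _ _ (Finset.mem_univ v)]
  rw [split, split (fun w => g (Γ w)), gain]
  have : ∑ w ∈ (Finset.univ.erase v).erase u, g (balancePair Γ v u w) =
      ∑ w ∈ (Finset.univ.erase v).erase u, g (Γ w) := by
    refine Finset.sum_congr rfl fun w hw => ?_
    simp only [Finset.mem_erase, Finset.mem_univ, and_true] at hw
    rw [balancePair, if_neg hw.2, if_neg hw.1]
  rw [this]
  simp only [balancePair, if_true, if_neg huv.symm]
  ring

lemma total_balancePair (Γ : V → ℕ) (v u : V) : ∑ w, balancePair Γ v u w = ∑ w, Γ w := by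
  have h := sum_balancePair (fun a => (a : ℝ)) Γ v u
  have h2 : gain (fun a => (a : ℝ)) (Γ v) (Γ u) = 0 := by
    have := (half_sum (Γ v) (Γ u)).1
    have : (((Γ v + Γ u + 1) / 2 : ℕ) : ℝ) + ((Γ v + Γ u) / 2 : ℕ) = Γ v + Γ u := by
      exact_mod_cast this
    rw [gain]
    linarith
  rw [h2, sub_zero] at h
  exact_mod_cast h

/-- The squared deviation of a load from the real number `μ`. -/
noncomputable def sqDev (μ : ℝ) (a : ℕ) : ℝ := ((a : ℝ) - μ) ^ 2

/-- The excess of a load around the integer `m`. -/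
noncomputable def excessAround (m : ℤ) (a : ℕ) : ℝ := excess ((a : ℤ) - m)

/-- With halves c, d of the sum, the gain equals ((a - b)² - (c - d)²)/2, independently of `μ`, and
|c - d| ≤ 1. -/
lemma gain_sqDev (μ : ℝ) (a b : ℕ) :
    0 ≤ gain (sqDev μ) a b ∧ (((a : ℝ) - b) ^ 2 - 1) / 2 ≤ gain (sqDev μ) a b := by
  obtain ⟨h1, h2⟩ := half_sum a b
  rw [gain]
  set c := (a + b + 1) / 2
  set d := (a + b) / 2
  have h1' : (c : ℝ) + d = a + b := by exact_mod_cast h1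
  have key : sqDev μ a + sqDev μ b - sqDev μ c - sqDev μ d
      = (((a : ℝ) - b) ^ 2 - ((c : ℝ) - d) ^ 2) / 2 := by
    obtain h : (c : ℝ) = a + b - d := by linarith
    simp only [sqDev, h]
    ring
  rw [key]
  rcases h2 with h | h
  · rw [h]
    constructor
    · nlinarith [sq_nonneg ((a : ℝ) - b)]
    · nlinarith [sq_nonneg ((a : ℝ) - b)]
  · have h3 : (c : ℝ) = d + 1 := by exact_mod_cast h
    rw [h3]
    -- Unequal halves mean that `a + b` is odd, so `a ≠ b`.
    have h4 : (1 : ℤ) ≤ ((a : ℤ) - b) ^ 2 := by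
      have : (a : ℤ) - b ≠ 0 := by omega
      have := sq_pos_of_ne_zero this
      omega
    have h5 : (1 : ℝ) ≤ ((a : ℝ) - b) ^ 2 := by exact_mod_cast h4
    constructor <;> nlinarith

lemma gain_excessAround_eq (m : ℤ) (a b : ℕ) : ∃ c d : ℤ,
    c + d = ((a : ℤ) - m) + (b - m) ∧ (c = d ∨ c = d + 1) ∧
    gain (excessAround m) a b =
      ((excess (a - m) + excess (b - m) - excess c - excess d : ℤ) : ℝ) := by
  obtain ⟨h1, h2⟩ := half_sum a b
  refine ⟨((a + b + 1) / 2 : ℕ) - m, ((a + b) / 2 : ℕ) - m, by omega, by omega, ?_⟩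
  simp only [gain, excessAround]
  push_cast
  rfl

lemma gain_excessAround_nonneg (m : ℤ) (a b : ℕ) : 0 ≤ gain (excessAround m) a b := by
  obtain ⟨c, d, hs, hcd, h⟩ := gain_excessAround_eq m a b
  rw [h]
  have := excess_add_excess_le hs hcd
  exact_mod_cast (by omega)

/-- If the squared deviations sum up to at least `n`, then the total gain of all ordered pairs is
at least `n / 2` times their sum. -/
lemma le_sum_gain_sqDev (Γ : V → ℕ) (μ : ℝ) (hμ : ∑ v, (Γ v : ℝ) = Fintype.card V * μ)
    (hn : (Fintype.card V : ℝ) ≤ ∑ v, sqDev μ (Γ v)) :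
    (Fintype.card V : ℝ) / 2 * ∑ v, sqDev μ (Γ v) ≤ ∑ v, ∑ u, gain (sqDev μ) (Γ v) (Γ u) := by
  set n : ℝ := (Fintype.card V : ℝ) with hn_def
  have hn0 : 0 ≤ n := Nat.cast_nonneg _
  set φ := ∑ v, sqDev μ (Γ v) with hφ
  have hz : ∑ v, ((Γ v : ℝ) - μ) = 0 := by
    rw [Finset.sum_sub_distrib, hμ]; simp [n]
  have h1 : ∑ v, ∑ u, (((Γ v : ℝ) - Γ u) ^ 2 - 1) / 2 = n * φ - n ^ 2 / 2 := by
    have : ∀ v u, (((Γ v : ℝ) - Γ u) ^ 2 - 1) / 2 = sqDev μ (Γ v) / 2 + sqDev μ (Γ u) / 2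
        - ((Γ v : ℝ) - μ) * ((Γ u : ℝ) - μ) - 1 / 2 := fun v u => by simp only [sqDev]; ring
    simp_rw [this, Finset.sum_sub_distrib, Finset.sum_add_distrib, ← Finset.mul_sum, hz]
    simp only [Finset.sum_const, Finset.card_univ, nsmul_eq_mul, mul_zero, ← Finset.mul_sum,
      ← Finset.sum_div, ← hφ]
    change n * (φ / 2) + n * (φ / 2) - 0 - n * (n * (1 / 2)) = _
    ring
  -- The rounding loss n²/2 is at most half of the main term because φ ≥ n.
  calc n / 2 * φ ≤ n * φ - n ^ 2 / 2 := by nlinarith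
    _ = _ := h1.symm
    _ ≤ _ := Finset.sum_le_sum fun v _ => Finset.sum_le_sum fun u _ => (gain_sqDev μ _ _).2

/-- If the squared deviations sum up to less than `n`, then the total gain of all ordered pairs,
measured by the excess, is at least `3 n / 32` times the total excess. -/
lemma le_sum_gain_excessAround (Γ : V → ℕ) (μ : ℝ) (m : ℤ)
    (hμ : ∑ v, (Γ v : ℝ) = Fintype.card V * μ) (hm : |μ - m| ≤ 1 / 2)
    (hn : ∑ v, sqDev μ (Γ v) < Fintype.card V) :
    3 * (Fintype.card V : ℝ) / 32 * ∑ v, excessAround m (Γ v) ≤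
      ∑ v, ∑ u, gain (excessAround m) (Γ v) (Γ u) := by
  set n : ℝ := (Fintype.card V : ℝ) with hn_def
  have hn0 : 0 ≤ n := Nat.cast_nonneg _
  have hz : ∑ v, ((Γ v : ℝ) - m) = n * (μ - m) := by
    rw [Finset.sum_sub_distrib, hμ]; simp [n]; ring
  have hsq : ∑ v, ((Γ v : ℝ) - m) ^ 2 ≤ n * (1 + (μ - m) ^ 2) := by
    have : ∀ v, ((Γ v : ℝ) - m) ^ 2 = sqDev μ (Γ v) + 2 * (μ - m) * ((Γ v : ℝ) - m)
        - (μ - m) ^ 2 := fun v => by simp only [sqDev]; ring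
    simp_rw [this, Finset.sum_sub_distrib, Finset.sum_add_distrib, ← Finset.mul_sum, hz]
    simp only [Finset.sum_const, Finset.card_univ, nsmul_eq_mul]
    change _ + _ - n * _ ≤ _
    nlinarith
  obtain ⟨hm1, hm2⟩ := abs_le.1 hm
  have hcore : ∀ s : ℝ, s ^ 2 = 1 →
      3 * n / 4 ≤ ∑ u, (3 + 2 * s * ((Γ u : ℝ) - m) - ((Γ u : ℝ) - m) ^ 2) := by
    intro s hs
    rw [Finset.sum_sub_distrib, Finset.sum_add_distrib, ← Finset.mul_sum, hz]
    simp only [Finset.sum_const, Finset.card_univ, nsmul_eq_mul]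
    change _ ≤ n * 3 + _ - _
    -- The worst case is s(μ - m) = -1/2, giving 2 - 1 - 1/4.
    have hδ : 3 / 4 ≤ 2 + 2 * s * (μ - m) - (μ - m) ^ 2 := by
      rcases mul_self_eq_one_iff.1 ((sq s).symm.trans hs) with rfl | rfl <;> nlinarith
    nlinarith [mul_le_mul_of_nonneg_left hδ hn0]
  rw [Finset.mul_sum]
  refine Finset.sum_le_sum fun v _ => ?_
  have he : 0 ≤ excessAround m (Γ v) := by
    simp only [excessAround]; exact_mod_cast excess_nonneg _
  -- The sign `s` is opposite to that of the deviation of `Γ v`: useful partners lie on the other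
  -- side of `m`.
  obtain ⟨s, hs, h⟩ : ∃ s : ℝ, s ^ 2 = 1 ∧ ∀ u, excessAround m (Γ v) / 8 *
      (3 + 2 * s * ((Γ u : ℝ) - m) - ((Γ u : ℝ) - m) ^ 2) ≤
        gain (excessAround m) (Γ v) (Γ u) := by
    rcases le_total 0 ((Γ v : ℤ) - m) with hv | hv
    · refine ⟨-1, by norm_num, fun u => ?_⟩
      obtain ⟨c, d, hsum, hcd, h⟩ := gain_excessAround_eq m (Γ v) (Γ u)
      have := excess_mul_le_of_nonneg hsum hcd hv
      have h' : (excessAround m (Γ v)) * (3 - 2 * ((Γ u : ℝ) - m) - ((Γ u : ℝ) - m) ^ 2) ≤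
        8 * gain (excessAround m) (Γ v) (Γ u) := by
        rw [h, excessAround]; exact_mod_cast this
      linarith
    · refine ⟨1, by norm_num, fun u => ?_⟩
      obtain ⟨c, d, hsum, hcd, h⟩ := gain_excessAround_eq m (Γ v) (Γ u)
      have := excess_mul_le_of_nonpos hsum hcd hv
      have h' : (excessAround m (Γ v)) * (3 + 2 * ((Γ u : ℝ) - m) - ((Γ u : ℝ) - m) ^ 2) ≤
        8 * gain (excessAround m) (Γ v) (Γ u) := by
        rw [h, excessAround]; exact_mod_cast this
      linarith
  calc 3 * n / 32 * excessAround m (Γ v) = excessAround m (Γ v) / 8 * (3 * n / 4) := by ring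
    _ ≤ excessAround m (Γ v) / 8 *
        ∑ u, (3 + 2 * s * ((Γ u : ℝ) - m) - ((Γ u : ℝ) - m) ^ 2) := by
      gcongr; exact hcore s hs
    _ ≤ _ := by
      rw [Finset.mul_sum]
      exact Finset.sum_le_sum fun u _ => h u

/-- Since `μ` is within 1/2 of `m`, a load outside [m - 1, m + 1] is closer to that interval than to
`μ`. This makes the change of potential harmless. -/
lemma excessAround_le_sqDev (μ : ℝ) (m : ℤ) (hm : |μ - m| ≤ 1 / 2) (a : ℕ) :
    excessAround m a ≤ sqDev μ a := by
  obtain ⟨hm1, hm2⟩ := abs_le.1 hm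
  rw [excessAround, sqDev]
  rcases le_or_gt ((a : ℤ) - m) (-1) with h | h
  · rw [excess_of_le_neg_one h]
    have : (a : ℝ) - m ≤ -1 := by exact_mod_cast h
    push_cast
    nlinarith
  rcases le_or_gt 1 ((a : ℤ) - m) with h' | h'
  · rw [excess_of_one_le h']
    have : 1 ≤ (a : ℝ) - m := by exact_mod_cast h'
    push_cast
    nlinarith
  · rw [excess_eq_zero (by omega) (by omega)]
    push_cast
    positivity

/-! ### Joining the two potentials -/

/-- The potential of a single load: the squared deviation from `μ` while the configuration is far
from balanced, and the excess around `m` afterwards. -/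
noncomputable def loadPotential (μ : ℝ) (m : ℤ) (Γ : V → ℕ) : ℕ → ℝ :=
  if (Fintype.card V : ℝ) ≤ ∑ v, sqDev μ (Γ v) then sqDev μ else excessAround m

/-- The potential of a configuration. -/
noncomputable def potential (μ : ℝ) (m : ℤ) (Γ : V → ℕ) : ℝ := ∑ v, loadPotential μ m Γ (Γ v)

lemma loadPotential_nonneg (μ : ℝ) (m : ℤ) (Γ : V → ℕ) (a : ℕ) : 0 ≤ loadPotential μ m Γ a := by
  unfold loadPotential
  split_ifs
  · exact sq_nonneg _
  · rw [excessAround]; exact_mod_cast excess_nonneg _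

lemma potential_nonneg (μ : ℝ) (m : ℤ) (Γ : V → ℕ) : 0 ≤ potential μ m Γ :=
  Finset.sum_nonneg fun _ _ => loadPotential_nonneg _ _ _ _

lemma gain_loadPotential_nonneg (μ : ℝ) (m : ℤ) (Γ : V → ℕ) (a b : ℕ) :
    0 ≤ gain (loadPotential μ m Γ) a b := by
  unfold loadPotential
  split_ifs
  · exact (gain_sqDev μ a b).1
  · exact gain_excessAround_nonneg m a b

lemma potential_le_sum_sqDev (μ : ℝ) (m : ℤ) (hm : |μ - m| ≤ 1 / 2) (Γ : V → ℕ) :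
    potential μ m Γ ≤ ∑ v, sqDev μ (Γ v) := by
  refine Finset.sum_le_sum fun v _ => ?_
  unfold loadPotential
  split_ifs
  · exact le_rfl
  · exact excessAround_le_sqDev μ m hm _

/-- The sum of squared deviations never increases, so the only possible change of regime is from
`sqDev` to `excessAround`, which lowers the potential further. -/
lemma potential_balancePair_add_gain_le (μ : ℝ) (m : ℤ) (hm : |μ - m| ≤ 1 / 2) (Γ : V → ℕ)
    (v u : V) :
    potential μ m (balancePair Γ v u) + gain (loadPotential μ m Γ) (Γ v) (Γ u) ≤
      potential μ m Γ := by
  have h := sum_balancePair (loadPotential μ m Γ) Γ v u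
  suffices potential μ m (balancePair Γ v u) ≤
      ∑ w, loadPotential μ m Γ (balancePair Γ v u w) by
    change _ ≤ ∑ w, loadPotential μ m Γ (Γ w)
    linarith
  by_cases hφ : (Fintype.card V : ℝ) ≤ ∑ v, sqDev μ (Γ v)
  · rw [loadPotential, if_pos hφ]
    exact potential_le_sum_sqDev μ m hm _
  · have hφ' : ¬ (Fintype.card V : ℝ) ≤ ∑ w, sqDev μ (balancePair Γ v u w) := by
      have := sum_balancePair (sqDev μ) Γ v u
      have := (gain_sqDev μ (Γ v) (Γ u)).1
      linarith
    rw [potential, loadPotential, loadPotential, if_neg hφ, if_neg hφ']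

lemma le_sum_gain_loadPotential (Γ : V → ℕ) (μ : ℝ) (m : ℤ)
    (hμ : ∑ v, (Γ v : ℝ) = Fintype.card V * μ) (hm : |μ - m| ≤ 1 / 2) :
    3 * (Fintype.card V : ℝ) / 32 * potential μ m Γ ≤
      ∑ v, ∑ u, gain (loadPotential μ m Γ) (Γ v) (Γ u) := by
  unfold potential loadPotential
  split_ifs with hφ
  · refine le_trans ?_ (le_sum_gain_sqDev Γ μ hμ hφ)
    refine mul_le_mul_of_nonneg_right ?_ (Finset.sum_nonneg fun _ _ => sq_nonneg _)
    have : (0 : ℝ) ≤ Fintype.card V := Nat.cast_nonneg _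
    linarith
  · exact le_sum_gain_excessAround Γ μ m hμ hm (not_le.1 hφ)

lemma isBalancedAround_of_potential_lt_one [Nonempty V] {μ : ℝ} {m : ℤ} {Γ : V → ℕ}
    (h : potential μ m Γ < 1) : IsBalancedAround m Γ := by
  unfold potential loadPotential at h
  split_ifs at h with hφ
  · have : (1 : ℝ) ≤ Fintype.card V := by exact_mod_cast Fintype.card_pos
    linarith
  intro v
  by_contra hv
  have h1 := one_le_excess (y := (Γ v : ℤ) - m) (by omega)
  have h2 : (1 : ℝ) ≤ excessAround m (Γ v) := by rw [excessAround]; exact_mod_cast h1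
  have h3 : excessAround m (Γ v) ≤ ∑ v, excessAround m (Γ v) :=
    Finset.single_le_sum (f := fun v => excessAround m (Γ v))
      (fun w _ => by simp only [excessAround]; exact_mod_cast excess_nonneg _) (Finset.mem_univ v)
  linarith

/-! ### Drift of the potential along the execution -/

lemma expect_balance_some {V : Type*} (Γ : V → ℕ) (v u : V) (f : (V → ℕ) → ℝ≥0∞) (b : ℝ≥0∞)
    (h1 : f (balancePair Γ v u) ≤ b) (h2 : f (balancePair Γ u v) ≤ b) :
    expect (balance Γ (some (v, u))) f ≤ b := by
  rw [balance, expect_map, ← expect_const (PMF.uniformOfFintype Bool) b]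
  refine expect_mono _ fun c => ?_
  cases c
  · simpa using h2
  · simpa using h1

section Drift

variable {V : Type*} [Fintype V]

/-- The potential on the configurations with `S` tokens, and `⊤` elsewhere. -/
noncomputable def cappedPotential (S : ℕ) (μ : ℝ) (m : ℤ) (Γ : V → ℕ) : ℝ≥0∞ :=
  if ∑ v, Γ v = S then ENNReal.ofReal (potential μ m Γ) else ⊤

/-- If every ordered pair of distinct vertices is matched with probability at least `κ`, the
expected potential decreases by the factor `1 - 3 κ n / 32`. -/
lemma expect_cappedPotential_le (ν : PMF (Option (V × V))) {κ : ℝ} (hκ : 0 ≤ κ)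
    (hν : ∀ v u, v ≠ u → ENNReal.ofReal κ ≤ ν (some (v, u)))
    (hκ1 : κ * (3 * (Fintype.card V : ℝ) / 32) < 1) {S : ℕ} {μ : ℝ} {m : ℤ}
    (hμ : (S : ℝ) = Fintype.card V * μ) (hm : |μ - m| ≤ 1 / 2) (Γ : V → ℕ) :
    expect ν (fun M => expect (balance Γ M) (cappedPotential S μ m)) ≤
      ENNReal.ofReal (1 - κ * (3 * (Fintype.card V : ℝ) / 32)) * cappedPotential S μ m Γ := by
  classical
  by_cases hS : ∑ v, Γ v = S
  swap
  -- The value `⊤` makes the bound trivial off the right token count, so token conservation need not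
  -- be tracked along trajectories; the contraction factor must be nonzero here.
  · rw [cappedPotential, if_neg hS, ENNReal.mul_top (by simpa using hκ1)]
    exact le_top
  set g := gain (loadPotential μ m Γ) with hg
  have hg0 : ∀ a b, 0 ≤ g a b := gain_loadPotential_nonneg μ m Γ
  set D : Option (V × V) → ℝ≥0∞ := fun M => M.elim 0 fun e => ENNReal.ofReal (g (Γ e.1) (Γ e.2))
  have hpair : ∀ v u, cappedPotential S μ m (balancePair Γ v u) ≤
      ENNReal.ofReal (potential μ m Γ - g (Γ v) (Γ u)) := by
    intro v u
    rw [cappedPotential, if_pos (by rw [total_balancePair, hS])]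
    refine ENNReal.ofReal_le_ofReal ?_
    have := potential_balancePair_add_gain_le μ m hm Γ v u
    linarith
  have hgle : ∀ v u, g (Γ v) (Γ u) ≤ potential μ m Γ := fun v u => by
    have := potential_balancePair_add_gain_le μ m hm Γ v u
    have := potential_nonneg μ m (balancePair Γ v u)
    linarith
  have hW : cappedPotential S μ m Γ = ENNReal.ofReal (potential μ m Γ) := if_pos hS
  -- Both roundings produce the same pair of values, hence the same gain. Keeping the gain on the
  -- left avoids truncated subtraction.
  have hpt : ∀ M, expect (balance Γ M) (cappedPotential S μ m) + D M ≤
      cappedPotential S μ m Γ := by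
    rintro (_ | ⟨v, u⟩)
    · simp [balance, expect_pure, D]
    · calc _ ≤ ENNReal.ofReal (potential μ m Γ - g (Γ v) (Γ u)) +
            ENNReal.ofReal (g (Γ v) (Γ u)) := by
            gcongr
            · refine expect_balance_some _ _ _ _ _ (hpair v u) ?_
              rw [hg, gain_comm]
              exact hpair u v
            · exact le_rfl
        _ = _ := by
          rw [← ENNReal.ofReal_add (by linarith [hgle v u]) (hg0 _ _), hW]
          congr 1
          ring
  have hD : ENNReal.ofReal (κ * (3 * (Fintype.card V : ℝ) / 32) * potential μ m Γ) ≤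
      expect ν D := by
    calc _ ≤ ENNReal.ofReal (κ * ∑ v, ∑ u, g (Γ v) (Γ u)) := by
          refine ENNReal.ofReal_le_ofReal ?_
          rw [mul_assoc]
          refine mul_le_mul_of_nonneg_left (le_sum_gain_loadPotential Γ μ m ?_ hm) hκ
          rw [← hμ, ← hS]
          push_cast
          rfl
      _ = ∑ e : V × V, ENNReal.ofReal κ * ENNReal.ofReal (g (Γ e.1) (Γ e.2)) := by
          rw [← Fintype.sum_prod_type', ENNReal.ofReal_mul hκ,
            ENNReal.ofReal_sum_of_nonneg fun _ _ => hg0 _ _, Finset.mul_sum]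
      _ ≤ ∑ e : V × V, ν (some e) * D (some e) := by
          refine Finset.sum_le_sum fun e _ => ?_
          by_cases he : e.1 = e.2
          · simp [he, hg, gain_self]
          · exact mul_le_mul' (hν e.1 e.2 he) le_rfl
      _ ≤ expect ν D := by
          rw [expect, tsum_fintype, Fintype.sum_option]
          exact le_add_self
  have hsum : expect ν (fun M => expect (balance Γ M) (cappedPotential S μ m)) +
      ENNReal.ofReal (κ * (3 * (Fintype.card V : ℝ) / 32) * potential μ m Γ) ≤
        ENNReal.ofReal (potential μ m Γ) := by
    refine (add_le_add_right hD _).trans ?_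
    rw [← expect_add, ← hW, ← expect_const ν (cappedPotential S μ m Γ)]
    exact expect_mono _ hpt
  rw [hW, ← ENNReal.ofReal_mul (by linarith), sub_mul, one_mul, ENNReal.ofReal_sub _
    (mul_nonneg (by positivity) (potential_nonneg μ m Γ))]
  exact ENNReal.le_sub_of_add_le_right ENNReal.ofReal_ne_top hsum

variable [Nonempty V]

/-- The matching at time t depends on the already known graph, so the potential itself need not
contract given the state. What contracts is `h`, its expectation after the next balancing: the new
graph is independent of the new loads given the state. The initial graph is arbitrary, so the first
balancing contributes no factor. -/
lemma lintegral_cappedPotential_le (p q : I) (Γ₀ : V → ℕ) (G₀ : SimpleGraph V) {κ : ℝ}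
    (hκ : 0 ≤ κ)
    (hν : ∀ G : SimpleGraph V, ∀ v u, v ≠ u →
      ENNReal.ofReal κ ≤ ((graphStep p q G).bind simpleMatching) (some (v, u)))
    (hκ1 : κ * (3 * (Fintype.card V : ℝ) / 32) < 1) {S : ℕ} {μ : ℝ} {m : ℤ}
    (hμ : (S : ℝ) = Fintype.card V * μ) (hm : |μ - m| ≤ 1 / 2) (t : ℕ) :
    ∫⁻ ω, cappedPotential S μ m (ω (t + 1)).load ∂executionLaw p q Γ₀ G₀ ≤
      ENNReal.ofReal (1 - κ * (3 * (Fintype.card V : ℝ) / 32)) ^ t *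
        cappedPotential S μ m Γ₀ := by
  set ρ := ENNReal.ofReal (1 - κ * (3 * (Fintype.card V : ℝ) / 32))
  set W : (V → ℕ) → ℝ≥0∞ := cappedPotential S μ m
  set h : State V → ℝ≥0∞ := fun s =>
    expect (simpleMatching s.graph) fun M => expect (balance s.load M) W with hh
  have hstep : ∀ s, expect (step p q s) (fun s' => W s'.load) = h s := fun s => by
    simp_rw [expect_step, expect_const, hh]
  have hdrift : ∀ s, expect (step p q s) h ≤ ρ * h s := fun s => by
    rw [expect_step]
    simp_rw [hh, ← expect_const_mul]
    refine expect_mono _ fun M => expect_mono _ fun Γ' => ?_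
    rw [← expect_bind (graphStep p q s.graph) simpleMatching
      (fun M => expect (balance Γ' M) W)]
    exact expect_cappedPotential_le _ hκ (hν s.graph) hκ1 hμ hm Γ'
  have hind : ∀ t : ℕ, ∫⁻ ω, h (ω t) ∂executionLaw p q Γ₀ G₀ ≤ ρ ^ t * h ⟨Γ₀, G₀⟩ := by
    intro t
    induction t with
    | zero => rw [lintegral_executionLaw_zero, pow_zero, one_mul]
    | succ t ih =>
      rw [lintegral_executionLaw_succ]
      calc _ ≤ ∫⁻ ω, ρ * h (ω t) ∂executionLaw p q Γ₀ G₀ := lintegral_mono fun ω => hdrift _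
        _ = ρ * ∫⁻ ω, h (ω t) ∂executionLaw p q Γ₀ G₀ :=
          lintegral_const_mul' _ _ ENNReal.ofReal_ne_top
        _ ≤ ρ * (ρ ^ t * h ⟨Γ₀, G₀⟩) := by gcongr
        _ = _ := by rw [pow_succ', mul_assoc]
  have h0 : h ⟨Γ₀, G₀⟩ ≤ W Γ₀ := by
    -- With `κ = 0` the drift bound is mere monotonicity, valid for any graph.
    have := expect_cappedPotential_le (simpleMatching G₀) (κ := 0) le_rfl (by simp) (by simp)
      hμ hm Γ₀
    simpa using this
  rw [lintegral_executionLaw_succ p q Γ₀ G₀ t fun s => W s.load]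
  simp_rw [hstep]
  exact (hind t).trans (by gcongr)

/-! ### The balancing time -/

lemma abs_sub_nearestInt_le (x : ℝ) : |x - nearestInt x| ≤ 1 / 2 := by
  have h1 := Int.le_ceil (x - 1 / 2)
  have h2 := Int.ceil_lt_add_one (x - 1 / 2)
  rw [nearestInt, abs_le]
  constructor <;> linarith

lemma card_mul_averageLoad (Γ : V → ℕ) :
    ((∑ v, Γ v : ℕ) : ℝ) = Fintype.card V * averageLoad Γ := by
  have : (Fintype.card V : ℝ) ≠ 0 := by simp
  rw [averageLoad]
  field_simp
  push_cast
  rfl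

lemma sqDev_averageLoad_le (Γ : V → ℕ) (v : V) :
    sqDev (averageLoad Γ) (Γ v) ≤ (discrepancy Γ : ℝ) ^ 2 := by
  have hn : (0 : ℝ) < Fintype.card V := by exact_mod_cast Fintype.card_pos
  set A := Finset.univ.sup' Finset.univ_nonempty Γ with hA
  set B := Finset.univ.inf' Finset.univ_nonempty Γ with hB
  have h1 : ∀ u, Γ u ≤ A := fun u => Finset.le_sup' Γ (Finset.mem_univ u)
  have h2 : ∀ u, B ≤ Γ u := fun u => Finset.inf'_le Γ (Finset.mem_univ u)
  have hd : (discrepancy Γ : ℝ) = A - B := by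
    rw [discrepancy, Nat.cast_sub ((h2 v).trans (h1 v))]
  have hs := card_mul_averageLoad Γ
  push_cast at hs
  have h3 : averageLoad Γ ≤ A := by
    have : ∑ u, (Γ u : ℝ) ≤ ∑ _u : V, (A : ℝ) :=
      Finset.sum_le_sum fun u _ => by exact_mod_cast h1 u
    rw [hs, Finset.sum_const, Finset.card_univ, nsmul_eq_mul] at this
    exact le_of_mul_le_mul_left this hn
  have h4 : (B : ℝ) ≤ averageLoad Γ := by
    have : ∑ _u : V, (B : ℝ) ≤ ∑ u, (Γ u : ℝ) :=
      Finset.sum_le_sum fun u _ => by exact_mod_cast h2 u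
    rw [hs, Finset.sum_const, Finset.card_univ, nsmul_eq_mul] at this
    exact le_of_mul_le_mul_left this hn
  have h5 : (Γ v : ℝ) ≤ A := by exact_mod_cast h1 v
  have h6 : (B : ℝ) ≤ Γ v := by exact_mod_cast h2 v
  rw [sqDev, hd]
  exact sq_le_sq' (by linarith) (by linarith)

lemma cappedPotential_initial_le (Γ₀ : V → ℕ) :
    cappedPotential (∑ v, Γ₀ v) (averageLoad Γ₀) (nearestInt (averageLoad Γ₀)) Γ₀ ≤
      ENNReal.ofReal (Fintype.card V * (discrepancy Γ₀ : ℝ) ^ 2) := by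
  rw [cappedPotential, if_pos rfl]
  refine ENNReal.ofReal_le_ofReal ?_
  refine (potential_le_sum_sqDev _ _ (abs_sub_nearestInt_le _) _).trans ?_
  refine (Finset.sum_le_sum fun v _ => sqDev_averageLoad_le Γ₀ v).trans (le_of_eq ?_)
  simp

/-- Markov's inequality at level 1: a potential below 1 at time `T` forces balance at that time. -/
lemma one_sub_le_prob_balancingTime_le (p q : I) (Γ₀ : V → ℕ) (G₀ : SimpleGraph V) (T : ℕ)
    {X x : ℝ} (hT : (T : ℝ) ≤ X) (hx : 0 ≤ x)
    (h : ∫⁻ ω, cappedPotential (∑ v, Γ₀ v) (averageLoad Γ₀) (nearestInt (averageLoad Γ₀))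
      (ω T).load ∂executionLaw p q Γ₀ G₀ ≤ ENNReal.ofReal x) :
    1 - x ≤ (executionLaw p q Γ₀ G₀).real
      {ω | (balancingTime Γ₀ ω : ℝ≥0∞) ≤ ENNReal.ofReal X} := by
  have : IsProbabilityMeasure (executionLaw p q Γ₀ G₀) := by unfold executionLaw; infer_instance
  set P := executionLaw p q Γ₀ G₀
  set W : State V → ℝ≥0∞ := fun s =>
    cappedPotential (∑ v, Γ₀ v) (averageLoad Γ₀) (nearestInt (averageLoad Γ₀)) s.load
  have hW : Measurable fun ω : ℕ → State V => W (ω T) :=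
    (Measurable.of_discrete (f := W)).comp (measurable_pi_apply T)
  set B : Set (ℕ → State V) := {ω | 1 ≤ W (ω T)}
  have hB : MeasurableSet B := measurableSet_le measurable_const hW
  have hPB : P.real B ≤ x := by
    have h1 := mul_meas_ge_le_lintegral (μ := P) hW 1
    rw [one_mul] at h1
    exact ENNReal.toReal_le_of_le_ofReal hx (h1.trans h)
  have hsub : Bᶜ ⊆ {ω | (balancingTime Γ₀ ω : ℝ≥0∞) ≤ ENNReal.ofReal X} := by
    intro ω hω
    have hlt : W (ω T) < 1 := not_le.1 hω
    simp only [W, cappedPotential] at hlt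
    split_ifs at hlt with hS
    · have hbal := isBalancedAround_of_potential_lt_one (ENNReal.ofReal_lt_one.1 hlt)
      have hle : balancingTime Γ₀ ω ≤ (T : ℕ∞) := iInf₂_le T hbal
      calc (balancingTime Γ₀ ω : ℝ≥0∞) ≤ ((T : ℕ∞) : ℝ≥0∞) := ENat.toENNReal_le.2 hle
        _ = ENNReal.ofReal T := by simp
        _ ≤ _ := ENNReal.ofReal_le_ofReal hT
    · exact absurd hlt (by simp)
  calc 1 - x ≤ 1 - P.real B := by linarith
    _ = P.real Bᶜ := (probReal_compl_eq_one_sub hB).symm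
    _ ≤ _ := measureReal_mono hsub

end Drift

/-! ### Choice of the constant and conclusion -/

lemma drift_pow_mul_le {θ a n D m M L : ℝ} {t : ℕ} (hθ : 0 < θ) (ha : 0 < a) (hn : 2 ≤ n)
    (hD : 1 ≤ D) (hm : 0 < m) (hmM : m ≤ M) (hM : M ≤ 1) (hθM : θ / n ≤ M)
    (hL : L = Real.log (D * n))
    (ht : ((2 + a) * (32 * (1 + θ) / (3 * θ)) + 2) * (M / m) * n * L - 2 ≤ t) :
    (1 - 3 / 32 * (m / (1 + n * M))) ^ t * (n * D ^ 2) ≤ n ^ (-a) := by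
  have hM0 : 0 < M := hm.trans_le hmM
  have hDn : n ≤ D * n := by nlinarith
  have hDn0 : 0 < D * n := by positivity
  have hLn : Real.log n ≤ L := by rw [hL]; exact Real.log_le_log (by linarith) hDn
  have hL2 : 1 / 2 ≤ L := by
    have h1 : Real.log 2 ≤ Real.log n := Real.log_le_log (by norm_num) hn
    have := Real.log_two_gt_d9
    linarith
  have hr : 1 ≤ M / m := (one_le_div hm).2 hmM
  set ε := 3 / 32 * (m / (1 + n * M)) with hε
  have hε1 : m / (1 + n * M) ≤ 1 := by
    rw [div_le_one (by positivity)]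
    nlinarith [mul_pos (by linarith : 0 < n) hM0]
  -- From θ ≤ nM one gets 1 + nM ≤ nM (1 + θ)/θ; only here does the density assumption enter.
  have hεle : 3 * θ / (32 * (1 + θ)) * (m / (n * M)) ≤ ε := by
    have h1 : θ ≤ n * M := by rwa [div_le_iff₀ (by linarith), mul_comm] at hθM
    rw [hε, div_mul_div_comm, div_mul_div_comm]
    rw [div_le_div_iff₀ (by positivity) (by positivity)]
    have : 0 ≤ 96 * m * (n * M - θ) := mul_nonneg (by positivity) (by linarith)
    nlinarith
  -- The summand 2 in the constant pays for the missing two steps; of the exponent, 2L cancels the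
  -- initial potential and aL leaves n^(-a).
  have hεt : (2 + a) * L ≤ ε * t := by
    have h2 : 2 ≤ 2 * (M / m) * n * L := by
      have : 1 * 2 ≤ M / m * n := mul_le_mul hr hn (by norm_num) (by positivity)
      nlinarith
    have h3 : (2 + a) * (32 * (1 + θ) / (3 * θ)) * (M / m) * n * L ≤ t := by linarith
    calc (2 + a) * L = 3 * θ / (32 * (1 + θ)) * (m / (n * M)) *
          ((2 + a) * (32 * (1 + θ) / (3 * θ)) * (M / m) * n * L) := by field_simp
      _ ≤ ε * t := mul_le_mul hεle h3 (by positivity) (by positivity)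
  have hpow : (1 - ε) ^ t ≤ Real.exp (-((2 + a) * L)) := by
    calc (1 - ε) ^ t ≤ Real.exp (-ε) ^ t := by
          refine pow_le_pow_left₀ (by rw [hε]; linarith) ?_ t
          have := Real.add_one_le_exp (-ε)
          linarith
      _ = Real.exp (-(ε * t)) := by rw [← Real.exp_nat_mul]; ring_nf
      _ ≤ _ := Real.exp_le_exp.2 (by linarith)
  have hinit : n * D ^ 2 ≤ Real.exp (2 * L) := by
    have : Real.exp (2 * L) = (D * n) ^ 2 := by
      rw [two_mul, Real.exp_add, hL, Real.exp_log hDn0, sq]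
    rw [this]
    nlinarith [sq_nonneg D]
  calc (1 - ε) ^ t * (n * D ^ 2) ≤ Real.exp (-((2 + a) * L)) * Real.exp (2 * L) :=
        mul_le_mul hpow hinit (by positivity) (by positivity)
    _ = Real.exp (-(a * L)) := by rw [← Real.exp_add]; ring_nf
    _ ≤ Real.exp (Real.log n * -a) := Real.exp_le_exp.2 (by nlinarith)
    _ = n ^ (-a) := (Real.rpow_def_of_pos (by linarith) _).symm

end EdgeMarkov

theorem mainTheorem4 (θ : ℝ) (hθ : 0 < θ) (a : ℝ) (ha : 0 < a) :
    ∃ C : ℝ, 0 < C ∧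
      ∀ (V : Type*) [Fintype V] [Nonempty V] (p q : unitInterval),
        0 < (p : ℝ) → (q : ℝ) < 1 →
        θ / (Fintype.card V : ℝ) ≤ max (p : ℝ) (1 - (q : ℝ)) →
        ∀ (G₀ : SimpleGraph V) (Γ₀ : V → ℕ),
          1 - (Fintype.card V : ℝ) ^ (-a) ≤
            (EdgeMarkov.executionLaw p q Γ₀ G₀).real
              {ω | (EdgeMarkov.balancingTime Γ₀ ω : ENNReal) ≤
                ENNReal.ofReal (C * EdgeMarkov.ratio p q * (Fintype.card V : ℝ) *
                  Real.log ((EdgeMarkov.discrepancy Γ₀ : ℝ) * (Fintype.card V : ℝ)))} := by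
  refine ⟨(2 + a) * (32 * (1 + θ) / (3 * θ)) + 2, by positivity, ?_⟩
  intro V _ _ p q hp hq hθM G₀ Γ₀
  set m := min (p : ℝ) (1 - q) with hm_def
  set M := max (p : ℝ) (1 - q) with hM_def
  set n : ℝ := (Fintype.card V : ℝ) with hn_def
  set D : ℝ := (EdgeMarkov.discrepancy Γ₀ : ℝ) with hD_def
  set C := (2 + a) * (32 * (1 + θ) / (3 * θ)) + 2
  have hn1 : 1 ≤ n := by rw [hn_def]; exact_mod_cast Fintype.card_pos
  have hm : 0 < m := lt_min hp (by linarith)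
  have hmM : m ≤ M := min_le_max
  have hM1 : M ≤ 1 := max_le p.2.2 (by linarith [q.2.1])
  have hinit := EdgeMarkov.cappedPotential_initial_le Γ₀
  rcases Nat.eq_zero_or_pos (EdgeMarkov.discrepancy Γ₀) with hD0 | hDpos
  -- With zero discrepancy the initial potential vanishes; `Real.log 0 = 0` makes the time bound 0.
  · refine EdgeMarkov.one_sub_le_prob_balancingTime_le p q Γ₀ G₀ 0 ?_ (by positivity) ?_
    · simp [hD_def, hD0]
    · rw [EdgeMarkov.lintegral_executionLaw_zero p q Γ₀ G₀ fun s =>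
        EdgeMarkov.cappedPotential _ _ _ s.load]
      refine hinit.trans (ENNReal.ofReal_le_ofReal ?_)
      rw [hD0]
      simp only [Nat.cast_zero, ne_eq, OfNat.ofNat_ne_zero, not_false_eq_true, zero_pow, mul_zero]
      positivity
  have hD1 : 1 ≤ D := by rw [hD_def]; exact_mod_cast hDpos
  have hn2 : 2 ≤ n := by
    by_contra hlt
    have hcard : Fintype.card V = 1 := by
      have h1 : Fintype.card V < 2 := by
        rw [hn_def] at hlt; exact_mod_cast not_le.1 hlt
      have := Fintype.card_pos (α := V)
      omega
    obtain ⟨v, hv⟩ := Fintype.card_eq_one_iff.1 hcard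
    have hconst : ∀ w, Γ₀ w = Γ₀ v := fun w => by rw [hv w]
    have : EdgeMarkov.discrepancy Γ₀ = 0 := by
      simp only [EdgeMarkov.discrepancy, Nat.sub_eq_zero_iff_le]
      refine (Finset.sup'_le _ _ fun w _ => (hconst w).le).trans ?_
      exact Finset.le_inf' _ _ fun w _ => (hconst w).ge
    omega
  set L := Real.log (D * n) with hL
  set X := C * EdgeMarkov.ratio p q * n * L
  have hratio : EdgeMarkov.ratio p q = M / m := rfl
  have hr : 1 ≤ M / m := (one_le_div hm).2 hmM
  have hX : 1 ≤ X := by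
    have hC : 2 ≤ C := by
      have : 0 < (2 + a) * (32 * (1 + θ) / (3 * θ)) := by positivity
      linarith
    have hL2 : 1 / 2 ≤ L := by
      have h1 : Real.log 2 ≤ L := Real.log_le_log (by norm_num) (by nlinarith)
      have := Real.log_two_gt_d9
      linarith
    have h1 : 2 * 1 ≤ C * (M / m) := mul_le_mul hC hr (by norm_num) (by linarith)
    have h2 : 2 * 1 * 2 ≤ C * (M / m) * n := mul_le_mul h1 hn2 (by norm_num) (by linarith)
    have h3 : 2 * 1 * 2 * (1 / 2) ≤ C * (M / m) * n * L :=
      mul_le_mul h2 hL2 (by norm_num) (by linarith)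
    rw [← hratio] at h3
    linarith
  -- The time is ⌊X⌋, of which t steps contract: one unit is lost to the floor and one to the first
  -- step, hence X - 2 ≤ t.
  obtain ⟨t, ht⟩ : ∃ t, ⌊X⌋₊ = t + 1 :=
    Nat.exists_eq_succ_of_ne_zero (Nat.floor_pos.2 hX).ne'
  have ht1 : ((t + 1 : ℕ) : ℝ) ≤ X := ht ▸ Nat.floor_le (by linarith)
  have ht2 : X - 2 ≤ t := by
    have := Nat.lt_floor_add_one X
    rw [ht] at this
    push_cast at this
    linarith
  refine EdgeMarkov.one_sub_le_prob_balancingTime_le p q Γ₀ G₀ (t + 1) ht1 (by positivity) ?_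
  set κ := n⁻¹ * (m / (1 + n * M))
  have hκn : κ * (3 * n / 32) = 3 / 32 * (m / (1 + n * M)) := by
    simp only [κ]; field_simp
  have hκ1 : m / (1 + n * M) ≤ 1 := by
    rw [div_le_one (by positivity)]
    nlinarith [mul_pos (by linarith : 0 < n) (hm.trans_le hmM)]
  refine (EdgeMarkov.lintegral_cappedPotential_le p q Γ₀ G₀ (κ := κ) (by positivity)
    (fun G v u huv => EdgeMarkov.le_graphStep_bind_simpleMatching p q G huv)
    (by rw [hκn]; linarith) (EdgeMarkov.card_mul_averageLoad Γ₀)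
    (EdgeMarkov.abs_sub_nearestInt_le _) t).trans ?_
  rw [← hn_def, hκn, ← ENNReal.ofReal_pow (by linarith)]
  refine (mul_le_mul_right hinit _).trans ?_
  rw [← ENNReal.ofReal_mul (pow_nonneg (by linarith) _)]
  exact ENNReal.ofReal_le_ofReal
    (EdgeMarkov.drift_pow_mul_le hθ ha hn2 hD1 hm hmM hM1 hθM hL ht2)
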